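/- Let $N\ge 2$ be an integer, let $\mathbb{R}^N_+=\mathbb{R}^{N-1}\times(0,\infty)$, and identify $\partial\mathbb{R}^N_+=\mathbb{R}^{N-1}\times\{0\}$ with $\mathbb{R}^{N-1}$, equipped with Lebesgue measure. For a locally integrable function $v\colon\partial\mathbb{R}^N_+\to\mathbb{R}$, its total variation is $$\int_{\partial\mathbb{R}^N_+}|\mathrm{D}v| = \sup\Bigl\{\int_{\mathbb{R}^{N-1}} v\,\operatorname{div}\varphi \;:\; \varphi\in C^1_c(\mathbb{R}^{N-1};\mathbb{R}^{N-1}),\ |\varphi|\le 1\Bigr\}\in[0,\infty],$$ and $v\in BV(\partial\mathbb{R}^N_+)$ means that $v$ is locally integrable and $\int_{\partial\mathbb{R}^N_+}|\mathrm{D}v|<\infty$ (integrability of $v$ itself over $\partial\mathbb{R}^N_+$ is not required). There exists a constant $C\in[0,\infty)$, depending only on $N$, such that the following holds. If the functions $u\colon\mathbb{R}^N_+\to\mathbb{R}$ and $v\colon\partial\mathbb{R}^N_+\to\mathbb{R}$ are (Lebesgue) measurable and satisfy $$\liminf_{s\to1^-}\,(1-s)\int_{\partial\mathbb{R}^N_+}\Bigl(\int_{\mathbb{R}^N_+}\frac{|v(x)-u(y)|}{|x-y|^{N+s}}\,\mathrm{d}y\Bigr)\mathrm{d}x<\infty,$$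 then $v\in BV(\partial\mathbb{R}^N_+)$ and $$\int_{\partial\mathbb{R}^N_+}|\mathrm{D}v|\le C\,\liminf_{s\to1^-}\,(1-s)\int_{\partial\mathbb{R}^N_+}\Bigl(\int_{\mathbb{R}^N_+}\frac{|v(x)-u(y)|}{|x-y|^{N+s}}\,\mathrm{d}y\Bigr)\mathrm{d}x.$$ -/

import Mathlib

open MeasureTheory Filter Topology
open scoped NNReal ENNReal

namespace TraceConjunction

/-- The open upper half-space `ℝ^N_+ = ℝ^(N-1) × (0, ∞)` of `ℝ^N`, where `N = n + 1`. -/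
def halfSpace (n : ℕ) : Set (EuclideanSpace ℝ (Fin (n + 1))) :=
  {y | 0 < y (Fin.last n)}

/-- The identification of `ℝ^n = ℝ^(N-1)` with the boundary `∂ℝ^N_+ = ℝ^(N-1) × {0}` of the
half-space, where `N = n + 1`. Functions on `∂ℝ^N_+` and integrals over it are functions on
`ℝ^n` and integrals for the Lebesgue measure of `ℝ^n`. -/
def boundaryPoint {n : ℕ} (x : EuclideanSpace ℝ (Fin n)) : EuclideanSpace ℝ (Fin (n + 1)) :=
  WithLp.toLp 2 (Fin.snoc (α := fun _ => ℝ) (fun i => x i) 0)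

/-- The trace conjunction integral with `p = 1` and `N = n + 1`,
`∫_{∂ℝ^N_+} (∫_{ℝ^N_+} |v x - u y| / |x - y|^(N + s) dy) dx`, with values in `[0, ∞]`.
Only the values of `u` on the half-space matter. -/
noncomputable def conjunctionIntegral {n : ℕ} (s : ℝ) (u : EuclideanSpace ℝ (Fin (n + 1)) → ℝ)
    (v : EuclideanSpace ℝ (Fin n) → ℝ) : ℝ≥0∞ :=
  ∫⁻ x : EuclideanSpace ℝ (Fin n), ∫⁻ y in halfSpace n,
    ENNReal.ofReal (|v x - u y| / ‖boundaryPoint x - y‖ ^ (((n + 1 : ℕ) : ℝ) + s))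

/-- The divergence of a vector field on `ℝ^n`. -/
noncomputable def divergence {n : ℕ}
    (φ : EuclideanSpace ℝ (Fin n) → EuclideanSpace ℝ (Fin n)) (x : EuclideanSpace ℝ (Fin n)) : ℝ :=
  ∑ i : Fin n, fderiv ℝ φ x (EuclideanSpace.single i 1) i

/-- The total variation `∫ |D v|` on `ℝ^n`: the supremum of `∫ v div φ` over all continuously
differentiable, compactly supported vector fields `φ` with `|φ| ≤ 1` everywhere. It is meant for
locally integrable `v`, for which all these integrals converge. -/
noncomputable def totalVariation {n : ℕ} (v : EuclideanSpace ℝ (Fin n) → ℝ) : ℝ≥0∞ :=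
  ⨆ (φ : EuclideanSpace ℝ (Fin n) → EuclideanSpace ℝ (Fin n)) (_ : ContDiff ℝ 1 φ)
    (_ : HasCompactSupport φ) (_ : ∀ x, ‖φ x‖ ≤ 1),
    ENNReal.ofReal (∫ x, v x * divergence φ x)

/-- Functions of bounded variation on `ℝ^n` (homogeneous space): locally integrable functions
of finite total variation, equivalently those whose distributional derivative is a finite
vector-valued Radon measure. -/
def IsBV {n : ℕ} (v : EuclideanSpace ℝ (Fin n) → ℝ) : Prop :=
  LocallyIntegrable v volume ∧ totalVariation v < ∞

end TraceConjunction

/-! On the slice at height `t` the kernel `|x - y|^(-(N + s))` is at least of order `t^(-(N + s))`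
for horizontal distances below `t`. So the conjunction integral dominates `∫ t^(-s) g(t) dt`, where
`g(t)` is `t^(-N)` times the integral of `|v x - u (z, t)|` over the pairs with `|x - z| < t`.
The measures `(1 - s) t^(-s) dt` concentrate at `0` as `s → 1`, so `liminf g` at `0` is controlled
by the right-hand side. Comparing `v (x + h)` and `v x` with `u (z, t)` for `z` close to the
midpoint of `x` and `x + h`, where `|h| ≤ t`, eliminates `u`: `g(t)` bounds the `L¹` norms of the
difference quotients of `v`, and these bound the total variation. -/

namespace TraceConjunction

section BallOscillation

theorem measurable_enorm_sub_prod {X F : Type*} [MeasurableSpace X] [NormedAddCommGroup F]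
    [MeasurableSpace F] [OpensMeasurableSpace F] [SecondCountableTopology F] {v w : X → F}
    (hv : Measurable v) (hw : Measurable w) :
    Measurable fun p : X × X => ‖v p.1 - w p.2‖ₑ := by
  simp_rw [← edist_eq_enorm_sub]
  exact (hv.comp measurable_fst).edist (hw.comp measurable_snd)

variable {X F : Type*} [PseudoMetricSpace X] [MeasurableSpace X] [NormedAddCommGroup F]

/-- The integral of `‖v x - w y‖` over the pairs of points at distance less than `t`. It measures
at scale `t` both the oscillation of `v` and the distance of `v` to `w`. -/
noncomputable def ballOscillation (μ : Measure X) (t : ℝ) (v w : X → F) : ℝ≥0∞ :=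
  ∫⁻ x, ∫⁻ y in Metric.ball x t, ‖v x - w y‖ₑ ∂μ ∂μ

variable [OpensMeasurableSpace X] {μ : Measure X}

theorem setLIntegral_ball_eq_lintegral_indicator (f : X × X → ℝ≥0∞) (x : X) (t : ℝ) :
    ∫⁻ y in Metric.ball x t, f (x, y) ∂μ =
      ∫⁻ y, {p : X × X | dist p.2 p.1 < t}.indicator f (x, y) ∂μ := by
  rw [← lintegral_indicator Metric.isOpen_ball.measurableSet]
  rfl

variable [SecondCountableTopology X]

theorem measurable_indicator_dist_lt {f : X × X → ℝ≥0∞} (hf : Measurable f) (t : ℝ) :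
    Measurable ({p : X × X | dist p.2 p.1 < t}.indicator f) :=
  hf.indicator (measurableSet_lt (by fun_prop) measurable_const)

variable [SFinite μ]

theorem measurable_setLIntegral_ball {f : X × X → ℝ≥0∞} (hf : Measurable f) (t : ℝ) :
    Measurable fun x => ∫⁻ y in Metric.ball x t, f (x, y) ∂μ := by
  simp_rw [setLIntegral_ball_eq_lintegral_indicator f]
  exact (measurable_indicator_dist_lt hf t).lintegral_prod_right'

theorem lintegral_setLIntegral_ball_swap {f : X × X → ℝ≥0∞} (hf : Measurable f) (t : ℝ) :
    ∫⁻ x, ∫⁻ y in Metric.ball x t, f (x, y) ∂μ ∂μ =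
      ∫⁻ y, ∫⁻ x in Metric.ball y t, f (x, y) ∂μ ∂μ := by
  simp_rw [setLIntegral_ball_eq_lintegral_indicator f]
  rw [lintegral_lintegral_swap (f := fun x y => {p : X × X | dist p.2 p.1 < t}.indicator f (x, y))
    (measurable_indicator_dist_lt hf t).aemeasurable]
  refine lintegral_congr fun y => ?_
  refine Eq.trans ?_ (setLIntegral_ball_eq_lintegral_indicator (f ∘ Prod.swap) y t).symm
  simp only [Set.indicator, Set.mem_ofPred_eq, dist_comm, Function.comp_apply, Prod.swap_prod_mk]

variable [MeasurableSpace F] [BorelSpace F] [SecondCountableTopology F] {v w : X → F}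

theorem ballOscillation_comm (hv : Measurable v) (hw : Measurable w) (t : ℝ) :
    ballOscillation μ t v w = ballOscillation μ t w v := by
  simp_rw [ballOscillation, ← enorm_sub_rev (v _) (w _)]
  exact lintegral_setLIntegral_ball_swap (measurable_enorm_sub_prod hv hw) t

theorem locallyIntegrable_of_ballOscillation_lt_top [IsLocallyFiniteMeasure μ] [μ.IsOpenPosMeasure]
    (hv : Measurable v) (hw : Measurable w) {t : ℝ} (ht : 0 < t)
    (h : ballOscillation μ t v w < ∞) : LocallyIntegrable v μ := by
  rw [ballOscillation_comm hv hw] at h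
  have h_ae : ∀ᵐ y ∂μ, ∫⁻ x in Metric.ball y t, ‖w y - v x‖ₑ ∂μ < ∞ :=
    ae_lt_top (measurable_setLIntegral_ball (measurable_enorm_sub_prod hw hv) t) h.ne
  intro z
  obtain ⟨y, hy, hzy⟩ := (Measure.dense_of_ae h_ae).exists_dist_lt z ht
  obtain ⟨U, hU, hμU⟩ := μ.finiteAt_nhds z
  refine ⟨U ∩ Metric.ball y t, inter_mem hU (Metric.isOpen_ball.mem_nhds hzy), ?_⟩
  have h_diff : IntegrableOn (fun x => w y - v x) (U ∩ Metric.ball y t) μ :=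
    IntegrableOn.mono_set ⟨(measurable_const.sub hv).aestronglyMeasurable, hy⟩
      Set.inter_subset_right
  have h_const : IntegrableOn (fun _ => w y) (U ∩ Metric.ball y t) μ :=
    integrableOn_const ((measure_mono Set.inter_subset_left).trans_lt hμU).ne
  simpa only [Pi.sub_def, sub_sub_cancel] using h_const.sub h_diff

end BallOscillation

section Translation

variable {E F : Type*} [NormedAddCommGroup E] [NormedSpace ℝ E] [NormedAddCommGroup F]

theorem ball_midpoint_add_subset {h : E} {t : ℝ} (hh : ‖h‖ ≤ t) (x : E) :
    Metric.ball (midpoint ℝ x (x + h)) (t / 2) ⊆ Metric.ball x t ∩ Metric.ball (x + h) t := by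
  refine Set.subset_inter (Metric.ball_subset_ball' ?_) (Metric.ball_subset_ball' ?_)
  · rw [dist_midpoint_left, dist_self_add_right, Real.norm_ofNat]
    linarith
  · rw [dist_midpoint_right, dist_self_add_right, Real.norm_ofNat]
    linarith

variable [MeasurableSpace E] [BorelSpace E] [MeasurableSpace F]
  [BorelSpace F] [SecondCountableTopology F] {μ : Measure E} [μ.IsAddHaarMeasure] {v w : E → F}
  {h : E} {t : ℝ}

theorem measure_ball_mul_enorm_translate_sub_le (v : E → F) (hw : Measurable w)
    (hh : ‖h‖ ≤ t) (x : E) :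
    μ (Metric.ball 0 (t / 2)) * ‖v (x + h) - v x‖ₑ ≤
      (∫⁻ y in Metric.ball (x + h) t, ‖v (x + h) - w y‖ₑ ∂μ) +
        ∫⁻ y in Metric.ball x t, ‖v x - w y‖ₑ ∂μ := by
  obtain ⟨h_left, h_right⟩ := Set.subset_inter_iff.1 (ball_midpoint_add_subset hh x)
  set B := Metric.ball (midpoint ℝ x (x + h)) (t / 2) with hB
  calc μ (Metric.ball 0 (t / 2)) * ‖v (x + h) - v x‖ₑ
      = ∫⁻ _ in B, ‖v (x + h) - v x‖ₑ ∂μ := by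
        rw [setLIntegral_const, mul_comm, hB, Measure.addHaar_ball_center μ (midpoint ℝ x _)]
    _ ≤ ∫⁻ y in B, (‖v (x + h) - w y‖ₑ + ‖v x - w y‖ₑ) ∂μ := by
        refine lintegral_mono fun y => ?_
        simpa only [edist_eq_enorm_sub] using edist_triangle_right (v (x + h)) (v x) (w y)
    _ = (∫⁻ y in B, ‖v (x + h) - w y‖ₑ ∂μ) + ∫⁻ y in B, ‖v x - w y‖ₑ ∂μ :=
        lintegral_add_left (measurable_const.sub hw).enorm _
    _ ≤ _ := add_le_add (lintegral_mono_set h_right) (lintegral_mono_set h_left)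

variable [FiniteDimensional ℝ E]

theorem measure_ball_mul_lintegral_translate_sub_le (hv : Measurable v) (hw : Measurable w)
    (hh : ‖h‖ ≤ t) :
    μ (Metric.ball 0 (t / 2)) * ∫⁻ x, ‖v (x + h) - v x‖ₑ ∂μ ≤ 2 * ballOscillation μ t v w := by
  have h_meas := measurable_setLIntegral_ball (μ := μ) (measurable_enorm_sub_prod hv hw) t
  rw [← lintegral_const_mul' _ _ measure_ball_lt_top.ne]
  refine (lintegral_mono (measure_ball_mul_enorm_translate_sub_le v hw hh)).trans_eq ?_
  rw [lintegral_add_right _ h_meas, two_mul]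
  congr 1
  exact lintegral_add_right_eq_self (fun x => ∫⁻ y in Metric.ball x t, ‖v x - w y‖ₑ ∂μ) h

theorem lintegral_translate_sub_div_le (hv : Measurable v) (hw : Measurable w) (ht : 0 < t)
    (hh : ‖h‖ ≤ t) :
    (∫⁻ x, ‖v (x + h) - v x‖ₑ ∂μ) / ENNReal.ofReal t ≤
      2 ^ (Module.finrank ℝ E + 1) / μ (Metric.ball 0 1) *
        (ballOscillation μ t v w / ENNReal.ofReal t ^ (Module.finrank ℝ E + 1)) := by
  have h_transl := measure_ball_mul_lintegral_translate_sub_le (μ := μ) hv hw hh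
  rw [Measure.addHaar_ball_of_pos _ _ (half_pos ht), ENNReal.ofReal_pow (half_pos ht).le,
    ENNReal.ofReal_div_of_pos two_pos, ENNReal.ofReal_ofNat] at h_transl
  set I := ∫⁻ x, ‖v (x + h) - v x‖ₑ ∂μ
  set d := Module.finrank ℝ E
  set T := ENNReal.ofReal t
  set ω := μ (Metric.ball 0 1)
  have hT : T * T⁻¹ = 1 :=
    ENNReal.mul_inv_cancel (ENNReal.ofReal_pos.2 ht).ne' ENNReal.ofReal_ne_top
  have hω : ω * ω⁻¹ = 1 :=
    ENNReal.mul_inv_cancel (Metric.measure_ball_pos _ _ one_pos).ne' measure_ball_lt_top.ne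
  have h2 : (2 : ℝ≥0∞) * 2⁻¹ = 1 := ENNReal.mul_inv_cancel two_ne_zero ENNReal.ofNat_ne_top
  calc I / T = (2 * 2⁻¹) ^ d * (T * T⁻¹) ^ d * (ω * ω⁻¹) * (I / T) := by simp [h2, hT, hω]
    _ = 2 ^ d * T⁻¹ ^ (d + 1) * ω⁻¹ * ((T / 2) ^ d * ω * I) := by
        simp only [div_eq_mul_inv]; ring
    _ ≤ 2 ^ d * T⁻¹ ^ (d + 1) * ω⁻¹ * (2 * ballOscillation μ t v w) := by gcongr
    _ = 2 ^ (d + 1) / ω * (ballOscillation μ t v w / T ^ (d + 1)) := by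
        simp only [div_eq_mul_inv, ENNReal.inv_pow]; ring

end Translation

section DifferenceQuotients

theorem enorm_integral_translate_sub_smul_le {E F : Type*} [NormedAddCommGroup E]
    [MeasurableSpace E] [BorelSpace E] [NormedAddCommGroup F] [NormedSpace ℝ F] {μ : Measure E}
    [μ.IsAddRightInvariant] {f : E → ℝ} {v : E → F} (hf : Continuous f)
    (hsupp : HasCompactSupport f) (hf1 : ∀ x, ‖f x‖ ≤ 1) (hv : LocallyIntegrable v μ) (h : E) :
    ‖(∫ x, f (x - h) • v x ∂μ) - ∫ x, f x • v x ∂μ‖ₑ ≤ ∫⁻ x, ‖v (x + h) - v x‖ₑ ∂μ := by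
  have h_int : Integrable (fun x => f x • v x) μ :=
    hv.integrable_smul_left_of_hasCompactSupport hf hsupp
  have hsupp' : HasCompactSupport fun x => f (x - h) :=
    hsupp.comp_homeomorph (Homeomorph.subRight h)
  have h_int' : Integrable (fun x => f (x - h) • v x) μ :=
    hv.integrable_smul_left_of_hasCompactSupport (by fun_prop) hsupp'
  have h_shift : ∫ x, f (x - h) • v x ∂μ = ∫ x, f x • v (x + h) ∂μ := by
    simpa using (integral_add_right_eq_self (fun x => f (x - h) • v x) h).symm
  rw [h_shift, ← integral_sub (by simpa using h_int'.comp_add_right h) h_int]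
  refine (enorm_integral_le_lintegral_enorm _).trans (lintegral_mono fun x => ?_)
  rw [← smul_sub, enorm_smul]
  exact mul_le_of_le_one_left' (by simpa [← ofReal_norm] using hf1 x)

variable {E F : Type*} [NormedAddCommGroup E] [NormedSpace ℝ E] [MeasurableSpace E] [BorelSpace E]
  [NormedAddCommGroup F] [NormedSpace ℝ F] {μ : Measure E} [SFinite μ] [μ.IsAddLeftInvariant]
  {f : E → ℝ} {v : E → F}

theorem hasDerivAt_integral_translate_smul (hf : ContDiff ℝ 1 f)
    (hsupp : HasCompactSupport f) (hv : LocallyIntegrable v μ) (e : E) :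
    HasDerivAt (fun t : ℝ => ∫ x, f (x - t • e) • v x ∂μ) (-∫ x, fderiv ℝ f x e • v x ∂μ) 0 := by
  -- The integral is the convolution of `v` with the reflection `g` of `f`, evaluated at `t • e`.
  let L : F →L[ℝ] ℝ →L[ℝ] F := (ContinuousLinearMap.lsmul ℝ ℝ).flip
  let g : E → ℝ := fun x => f (-x)
  have hg : ContDiff ℝ 1 g := hf.comp contDiff_neg
  have hg_supp : HasCompactSupport g := hsupp.comp_homeomorph (Homeomorph.neg E)
  have h_fderiv : ∀ x, fderiv ℝ g (-x) = -fderiv ℝ f x := fun x => by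
    simpa [g] using fderiv_comp_smul (𝕜 := ℝ) (f := f) (x := -x) (-1)
  have h_line : HasDerivAt (fun t : ℝ => t • e) e 0 := by
    simpa using (hasDerivAt_id (0 : ℝ)).smul_const e
  have h_conv := (hg_supp.hasFDerivAt_convolution_right L hv hg ((0 : ℝ) • e)).comp_hasDerivAt 0
    h_line
  rw [convolution_precompR_apply L hv (hg_supp.fderiv ℝ) (hg.continuous_fderiv one_ne_zero)]
    at h_conv
  simpa [Function.comp_def, convolution_def, L, g, h_fderiv, integral_neg] using h_conv

theorem enorm_integral_fderiv_smul_le_liminf (hf : ContDiff ℝ 1 f) (hsupp : HasCompactSupport f)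
    (hf1 : ∀ x, ‖f x‖ ≤ 1) (hv : LocallyIntegrable v μ) (e : E) :
    ‖∫ x, fderiv ℝ f x e • v x ∂μ‖ₑ ≤
      liminf (fun t : ℝ => (∫⁻ x, ‖v (x + t • e) - v x‖ₑ ∂μ) / ENNReal.ofReal t) (𝓝[>] 0) := by
  have h_slope := (hasDerivAt_integral_translate_smul hf hsupp hv e).tendsto_slope_zero_right.enorm
  rw [← enorm_neg, ← h_slope.liminf_eq]
  refine liminf_le_liminf (eventually_mem_nhdsWithin.mono fun t (ht : 0 < t) => ?_)
  rw [enorm_smul, enorm_inv ht.ne', Real.enorm_of_nonneg ht.le, ENNReal.div_eq_inv_mul]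
  gcongr
  simpa using enorm_integral_translate_sub_smul_le hf.continuous hsupp hf1 hv (t • e)

end DifferenceQuotients

section TotalVariation

variable {n : ℕ} {v : EuclideanSpace ℝ (Fin n) → ℝ}
  {φ : EuclideanSpace ℝ (Fin n) → EuclideanSpace ℝ (Fin n)}

theorem divergence_eq_sum_fderiv (hφ : Differentiable ℝ φ) (x : EuclideanSpace ℝ (Fin n)) :
    divergence φ x = ∑ i, fderiv ℝ (fun y => φ y i) x (EuclideanSpace.single i 1) := by
  refine Finset.sum_congr rfl fun i _ => ?_
  have h := (EuclideanSpace.proj i : EuclideanSpace ℝ (Fin n) →L[ℝ] ℝ).hasFDerivAt.comp x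
    (hφ x).hasFDerivAt
  exact (DFunLike.congr_fun h.fderiv _).symm

theorem integral_mul_divergence (hφ : ContDiff ℝ 1 φ) (hsupp : HasCompactSupport φ)
    (hv : LocallyIntegrable v volume) :
    ∫ x, v x * divergence φ x =
      ∑ i, ∫ x, fderiv ℝ (fun y => φ y i) x (EuclideanSpace.single i 1) • v x := by
  have h_coord : ∀ i, ContDiff ℝ 1 fun y => φ y i := contDiff_euclidean.1 hφ
  rw [← integral_finsetSum]
  · simp_rw [divergence_eq_sum_fderiv (hφ.differentiable one_ne_zero), smul_eq_mul,
      ← Finset.sum_mul, mul_comm]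
  · intro i _
    have h_supp : HasCompactSupport fun y => φ y i :=
      hsupp.comp_left (g := fun z : EuclideanSpace ℝ (Fin n) => z i) rfl
    exact hv.integrable_smul_left_of_hasCompactSupport
      (((h_coord i).continuous_fderiv one_ne_zero).clm_apply continuous_const)
      (h_supp.fderiv_apply ℝ _)

theorem totalVariation_le_sum_liminf (hv : LocallyIntegrable v volume) :
    totalVariation v ≤ ∑ i, liminf (fun t : ℝ =>
      (∫⁻ x, ‖v (x + t • EuclideanSpace.single i 1) - v x‖ₑ) / ENNReal.ofReal t) (𝓝[>] 0) := by
  refine iSup₂_le fun φ hφ => iSup₂_le fun hsupp hφ1 => ?_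
  rw [integral_mul_divergence hφ hsupp hv]
  refine (Real.ofReal_le_enorm _).trans ((enorm_sum_le _ _).trans (Finset.sum_le_sum fun i _ => ?_))
  exact enorm_integral_fderiv_smul_le_liminf (contDiff_euclidean.1 hφ i)
    (hsupp.comp_left (g := fun z : EuclideanSpace ℝ (Fin n) => z i) rfl)
    (fun x => (PiLp.norm_apply_le (φ x) i).trans (hφ1 x)) hv _

theorem totalVariation_le_liminf_ballOscillation (hv : Measurable v)
    (hv_loc : LocallyIntegrable v volume) {w : ℝ → EuclideanSpace ℝ (Fin n) → ℝ}
    (hw : ∀ t, Measurable (w t)) :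
    totalVariation v ≤
      n * (2 ^ (n + 1) / volume (Metric.ball (0 : EuclideanSpace ℝ (Fin n)) 1) *
        liminf (fun t => ballOscillation volume t v (w t) / ENNReal.ofReal t ^ (n + 1))
          (𝓝[>] 0)) := by
  set ω := volume (Metric.ball (0 : EuclideanSpace ℝ (Fin n)) 1)
  have hω0 : ω ≠ 0 := (Metric.measure_ball_pos _ _ one_pos).ne'
  have hω_top : ω ≠ ∞ := measure_ball_lt_top.ne
  rw [← ENNReal.liminf_const_mul_of_ne_zero_of_ne_top
    (ENNReal.div_ne_zero.2 ⟨by simp, hω_top⟩) (ENNReal.div_ne_top (by finiteness) hω0)]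
  refine (totalVariation_le_sum_liminf hv_loc).trans ?_
  refine (Finset.sum_le_card_nsmul _ _ _ fun i _ => liminf_le_liminf ?_).trans_eq
    (by rw [Finset.card_univ, Fintype.card_fin, nsmul_eq_mul])
  filter_upwards [self_mem_nhdsWithin] with t (ht : 0 < t)
  have h_norm : ‖t • EuclideanSpace.single i (1 : ℝ)‖ ≤ t := by
    simp [norm_smul, abs_of_pos ht]
  simpa only [finrank_euclideanSpace_fin] using
    lintegral_translate_sub_div_le (μ := volume) hv (hw t) ht h_norm

theorem totalVariation_congr {v' : EuclideanSpace ℝ (Fin n) → ℝ} (hv : v =ᵐ[volume] v') :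
    totalVariation v = totalVariation v' := by
  have h : ∀ φ, ∫ x, v x * divergence φ x = ∫ x, v' x * divergence φ x := fun φ =>
    integral_congr_ae (hv.mono fun x hx => by simp only [hx])
  simp_rw [totalVariation, h]

end TotalVariation

section Concentration

theorem lintegral_Ioo_rpow_neg {s δ : ℝ} (hs : s < 1) (hδ : 0 < δ) :
    ∫⁻ t in Set.Ioo 0 δ, ENNReal.ofReal (t ^ (-s)) = ENNReal.ofReal (δ ^ (1 - s) / (1 - s)) := by
  have h_int : IntegrableOn (fun t : ℝ => t ^ (-s)) (Set.Ioo 0 δ) :=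
    (intervalIntegral.integrableOn_Ioo_rpow_iff hδ).2 (by linarith)
  rw [← ofReal_integral_eq_lintegral_ofReal h_int]
  · rw [← integral_Ioc_eq_integral_Ioo, ← intervalIntegral.integral_of_le hδ.le,
      integral_rpow (Or.inl (by linarith)), Real.zero_rpow (by linarith), neg_add_eq_sub, sub_zero]
  · filter_upwards [ae_restrict_mem measurableSet_Ioo] with t ht
    exact Real.rpow_nonneg ht.1.le _

theorem tendsto_one_sub_mul_lintegral_Ioo_rpow_neg {δ : ℝ} (hδ : 0 < δ) :
    Tendsto (fun s : ℝ => ENNReal.ofReal (1 - s) *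
      ∫⁻ t in Set.Ioo 0 δ, ENNReal.ofReal (t ^ (-s))) (𝓝[<] 1) (𝓝 1) := by
  have h_cont : Continuous fun s : ℝ => ENNReal.ofReal (δ ^ (1 - s)) :=
    ENNReal.continuous_ofReal.comp ((Real.continuous_const_rpow hδ.ne').comp (by fun_prop))
  have h_lim : Tendsto (fun s : ℝ => ENNReal.ofReal (δ ^ (1 - s))) (𝓝[<] 1) (𝓝 1) := by
    simpa using h_cont.continuousWithinAt.tendsto (x := (1 : ℝ)) (s := Set.Iio 1)
  refine h_lim.congr' (eventually_mem_nhdsWithin.mono fun s (hs : s < 1) => ?_)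
  dsimp only
  rw [lintegral_Ioo_rpow_neg hs hδ, ← ENNReal.ofReal_mul (sub_pos.2 hs).le,
    mul_div_cancel₀ _ (sub_pos.2 hs).ne']

theorem liminf_nhdsGT_zero_le_liminf_lintegral_rpow_neg (g : ℝ → ℝ≥0∞) :
    liminf g (𝓝[>] 0) ≤ liminf (fun s : ℝ => ENNReal.ofReal (1 - s) *
      ∫⁻ t in Set.Ioi 0, ENNReal.ofReal (t ^ (-s)) * g t) (𝓝[<] 1) := by
  refine le_of_forall_lt_imp_le_of_dense fun c hc => ?_
  obtain ⟨δ, hδ, hδc⟩ := mem_nhdsGT_iff_exists_Ioo_subset.1 (eventually_lt_of_lt_liminf hc)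
  have h_lim : Tendsto (fun s : ℝ => ENNReal.ofReal (1 - s) *
      (∫⁻ t in Set.Ioo 0 δ, ENNReal.ofReal (t ^ (-s))) * c) (𝓝[<] 1) (𝓝 c) := by
    simpa using ENNReal.Tendsto.mul_const (tendsto_one_sub_mul_lintegral_Ioo_rpow_neg hδ)
      (Or.inr hc.ne_top)
  rw [← h_lim.liminf_eq]
  refine liminf_le_liminf (Eventually.of_forall fun s => ?_)
  rw [mul_assoc, ← lintegral_mul_const' _ _ hc.ne_top]
  refine mul_le_mul_right ?_ _
  calc ∫⁻ t in Set.Ioo 0 δ, ENNReal.ofReal (t ^ (-s)) * c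
      ≤ ∫⁻ t in Set.Ioo 0 δ, ENNReal.ofReal (t ^ (-s)) * g t :=
        setLIntegral_mono' measurableSet_Ioo fun t ht => mul_le_mul_right (hδc ht).le _
    _ ≤ ∫⁻ t in Set.Ioi 0, ENNReal.ofReal (t ^ (-s)) * g t :=
        lintegral_mono_set Set.Ioo_subset_Ioi_self

end Concentration

section Slicing

variable {n : ℕ}

/-- The point of `ℝ^(n+1)` with horizontal part `z` and last coordinate `t`; `boundaryPoint` is
the case `t = 0`. -/
def heightPoint (t : ℝ) (z : EuclideanSpace ℝ (Fin n)) : EuclideanSpace ℝ (Fin (n + 1)) :=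
  WithLp.toLp 2 (Fin.snoc (α := fun _ => ℝ) (fun i => z i) t)

theorem norm_boundaryPoint_sub_heightPoint_sq (x z : EuclideanSpace ℝ (Fin n)) (t : ℝ) :
    ‖boundaryPoint x - heightPoint t z‖ ^ 2 = ‖x - z‖ ^ 2 + t ^ 2 := by
  simp [EuclideanSpace.norm_sq_eq, Fin.sum_univ_castSucc, boundaryPoint, heightPoint]

theorem measurePreserving_heightPoint :
    MeasurePreserving (fun p : ℝ × EuclideanSpace ℝ (Fin n) => heightPoint p.1 p.2) := by
  have h_ofLp : MeasurePreserving (Prod.map id (@WithLp.ofLp 2 (Fin n → ℝ)))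
      (volume.prod volume) (volume.prod volume) :=
    (MeasurePreserving.id (volume : Measure ℝ)).prod (PiLp.volume_preserving_ofLp (Fin n))
  have h_snoc : MeasurePreserving fun p : ℝ × (Fin n → ℝ) =>
      Fin.snoc (α := fun _ => ℝ) p.2 p.1 := by
    simpa [MeasurableEquiv.piFinSuccAbove, Fin.insertNthEquiv] using
      (volume_preserving_piFinSuccAbove (fun _ : Fin (n + 1) => ℝ) (Fin.last n)).symm
  exact (PiLp.volume_preserving_toLp (Fin (n + 1))).comp (h_snoc.comp h_ofLp)

theorem continuous_heightPoint :
    Continuous fun p : ℝ × EuclideanSpace ℝ (Fin n) => heightPoint p.1 p.2 :=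
  (PiLp.continuous_toLp 2 _).comp (Continuous.finSnoc (by fun_prop) continuous_fst)

theorem lintegral_halfSpace {f : EuclideanSpace ℝ (Fin (n + 1)) → ℝ≥0∞} (hf : Measurable f) :
    ∫⁻ y in halfSpace n, f y = ∫⁻ t in Set.Ioi (0 : ℝ), ∫⁻ z, f (heightPoint t z) := by
  have h_meas : MeasurableSet (halfSpace n) := measurableSet_lt measurable_const (by fun_prop)
  have h_preimage : (fun p : ℝ × EuclideanSpace ℝ (Fin n) => heightPoint p.1 p.2) ⁻¹' halfSpace n =
      Set.Ioi 0 ×ˢ Set.univ := by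
    ext p
    simp [halfSpace, heightPoint]
  rw [← measurePreserving_heightPoint.setLIntegral_comp_preimage h_meas hf, h_preimage,
    Measure.volume_eq_prod, setLIntegral_prod (fun p => f (heightPoint p.1 p.2))
      (hf.comp continuous_heightPoint.measurable).aemeasurable]
  simp only [Measure.restrict_univ]

variable {u : EuclideanSpace ℝ (Fin (n + 1)) → ℝ} {v : EuclideanSpace ℝ (Fin n) → ℝ}

theorem measurable_conjunctionIntegrand (hu : Measurable u) (hv : Measurable v) (a : ℝ) :
    Measurable fun p : EuclideanSpace ℝ (Fin n) × EuclideanSpace ℝ (Fin (n + 1)) =>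
      ENNReal.ofReal (|v p.1 - u p.2| / ‖boundaryPoint p.1 - p.2‖ ^ a) := by
  have h_boundary : Measurable (boundaryPoint : EuclideanSpace ℝ (Fin n) → _) :=
    (continuous_heightPoint.comp (Continuous.prodMk_right 0)).measurable
  fun_prop

theorem conjunctionIntegral_eq_lintegral_height (hu : Measurable u) (hv : Measurable v) (s : ℝ) :
    conjunctionIntegral s u v = ∫⁻ t in Set.Ioi (0 : ℝ), ∫⁻ x, ∫⁻ z,
      ENNReal.ofReal (|v x - u (heightPoint t z)| /
        ‖boundaryPoint x - heightPoint t z‖ ^ (((n + 1 : ℕ) : ℝ) + s)) := by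
  have h_meas := measurable_conjunctionIntegrand hu hv (((n + 1 : ℕ) : ℝ) + s)
  have h_point : Measurable fun q : (EuclideanSpace ℝ (Fin n) × ℝ) × EuclideanSpace ℝ (Fin n) =>
      (q.1.1, heightPoint q.1.2 q.2) :=
    measurable_fst.fst.prodMk
      (continuous_heightPoint.measurable.comp (measurable_fst.snd.prodMk measurable_snd))
  calc conjunctionIntegral s u v
      = ∫⁻ x, ∫⁻ t in Set.Ioi (0 : ℝ), ∫⁻ z, ENNReal.ofReal (|v x - u (heightPoint t z)| /
          ‖boundaryPoint x - heightPoint t z‖ ^ (((n + 1 : ℕ) : ℝ) + s)) :=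
        lintegral_congr fun x => lintegral_halfSpace (h_meas.comp measurable_prodMk_left)
    _ = _ := lintegral_lintegral_swap
        (h_meas.comp h_point).lintegral_prod_right'.aemeasurable

theorem rpow_norm_boundaryPoint_sub_heightPoint_le {s t : ℝ} (hs0 : 0 ≤ s) (hs1 : s ≤ 1)
    (ht : 0 < t) {x z : EuclideanSpace ℝ (Fin n)} (hz : dist z x < t) :
    ‖boundaryPoint x - heightPoint t z‖ ^ (((n + 1 : ℕ) : ℝ) + s) ≤
      2 ^ (n + 2) * (t ^ (n + 1) * t ^ s) := by
  have h_norm : ‖boundaryPoint x - heightPoint t z‖ ≤ 2 * t := by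
    have h_sq := norm_boundaryPoint_sub_heightPoint_sq x z t
    rw [dist_comm, dist_eq_norm] at hz
    refine le_of_sq_le_sq ?_ (by positivity)
    nlinarith [norm_nonneg (x - z)]
  calc _ ≤ (2 * t) ^ (((n + 1 : ℕ) : ℝ) + s) :=
        Real.rpow_le_rpow (norm_nonneg _) h_norm (by positivity)
    _ = 2 ^ (((n + 1 : ℕ) : ℝ) + s) * (t ^ (n + 1) * t ^ s) := by
        rw [Real.mul_rpow zero_le_two ht.le, Real.rpow_add ht, Real.rpow_natCast]
    _ ≤ 2 ^ (n + 2) * (t ^ (n + 1) * t ^ s) := by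
        gcongr
        rw [← Real.rpow_natCast]
        refine Real.rpow_le_rpow_of_exponent_le one_le_two ?_
        push_cast
        linarith

theorem rpow_neg_div_pow_mul_le_div_rpow_norm {s t : ℝ} (hs0 : 0 ≤ s) (hs1 : s ≤ 1) (ht : 0 < t)
    {x z : EuclideanSpace ℝ (Fin n)} (hz : dist z x < t) {a : ℝ} (ha : 0 ≤ a) :
    t ^ (-s) / t ^ (n + 1) * a ≤
      2 ^ (n + 2) * (a / ‖boundaryPoint x - heightPoint t z‖ ^ (((n + 1 : ℕ) : ℝ) + s)) := by
  have h_norm_pos : 0 < ‖boundaryPoint x - heightPoint t z‖ := by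
    refine (norm_nonneg _).lt_of_ne' (sq_pos_iff.1 ?_)
    rw [norm_boundaryPoint_sub_heightPoint_sq]
    positivity
  calc t ^ (-s) / t ^ (n + 1) * a
      = 2 ^ (n + 2) * (a / (2 ^ (n + 2) * (t ^ (n + 1) * t ^ s))) := by
        rw [Real.rpow_neg ht.le]
        field_simp
    _ ≤ _ := by
        gcongr
        exact rpow_norm_boundaryPoint_sub_heightPoint_le hs0 hs1 ht hz

theorem rpow_neg_mul_ballOscillation_le {s t : ℝ} (hs0 : 0 ≤ s) (hs1 : s ≤ 1) (ht : 0 < t)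
    (u : EuclideanSpace ℝ (Fin (n + 1)) → ℝ) (v : EuclideanSpace ℝ (Fin n) → ℝ) :
    ENNReal.ofReal (t ^ (-s)) *
        (ballOscillation volume t v (fun z => u (heightPoint t z)) / ENNReal.ofReal t ^ (n + 1)) ≤
      2 ^ (n + 2) * ∫⁻ x, ∫⁻ z, ENNReal.ofReal (|v x - u (heightPoint t z)| /
        ‖boundaryPoint x - heightPoint t z‖ ^ (((n + 1 : ℕ) : ℝ) + s)) := by
  have h_coeff : ENNReal.ofReal (t ^ (-s)) / ENNReal.ofReal t ^ (n + 1) =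
      ENNReal.ofReal (t ^ (-s) / t ^ (n + 1)) := by
    rw [← ENNReal.ofReal_pow ht.le, ENNReal.ofReal_div_of_pos (by positivity)]
  have h_two : (2 : ℝ≥0∞) ^ (n + 2) = ENNReal.ofReal (2 ^ (n + 2)) := by
    rw [ENNReal.ofReal_pow zero_le_two, ENNReal.ofReal_ofNat]
  rw [← mul_div_assoc, ENNReal.mul_div_right_comm, h_coeff, h_two, ballOscillation,
    ← lintegral_const_mul' _ _ ENNReal.ofReal_ne_top,
    ← lintegral_const_mul' _ _ ENNReal.ofReal_ne_top]
  refine lintegral_mono fun x => ?_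
  rw [← lintegral_const_mul' _ _ ENNReal.ofReal_ne_top,
    ← lintegral_const_mul' _ _ ENNReal.ofReal_ne_top]
  refine le_trans ?_ (setLIntegral_le_lintegral (Metric.ball x t) _)
  refine setLIntegral_mono' Metric.isOpen_ball.measurableSet fun z hz => ?_
  rw [Real.enorm_eq_ofReal_abs, ← ENNReal.ofReal_mul (by positivity),
    ← ENNReal.ofReal_mul (by positivity)]
  exact ENNReal.ofReal_le_ofReal
    (rpow_neg_div_pow_mul_le_div_rpow_norm hs0 hs1 ht hz (abs_nonneg _))

theorem lintegral_rpow_neg_mul_ballOscillation_le (hu : Measurable u) (hv : Measurable v) {s : ℝ}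
    (hs0 : 0 ≤ s) (hs1 : s ≤ 1) :
    ∫⁻ t in Set.Ioi (0 : ℝ), ENNReal.ofReal (t ^ (-s)) *
        (ballOscillation volume t v (fun z => u (heightPoint t z)) / ENNReal.ofReal t ^ (n + 1)) ≤
      2 ^ (n + 2) * conjunctionIntegral s u v := by
  rw [conjunctionIntegral_eq_lintegral_height hu hv, ← lintegral_const_mul' _ _ (by finiteness)]
  exact setLIntegral_mono' measurableSet_Ioi fun t ht =>
    rpow_neg_mul_ballOscillation_le hs0 hs1 ht u v

theorem liminf_ballOscillation_le_liminf_conjunctionIntegral (hu : Measurable u)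
    (hv : Measurable v) :
    liminf (fun t : ℝ => ballOscillation volume t v (fun z => u (heightPoint t z)) /
        ENNReal.ofReal t ^ (n + 1)) (𝓝[>] 0) ≤
      2 ^ (n + 2) * liminf (fun s : ℝ => ENNReal.ofReal (1 - s) * conjunctionIntegral s u v)
        (𝓝[<] (1 : ℝ)) := by
  rw [← ENNReal.liminf_const_mul_of_ne_zero_of_ne_top (by simp) (by finiteness)]
  refine (liminf_nhdsGT_zero_le_liminf_lintegral_rpow_neg _).trans (liminf_le_liminf ?_)
  filter_upwards [Ioo_mem_nhdsLT zero_lt_one] with s hs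
  rw [mul_left_comm]
  gcongr
  exact lintegral_rpow_neg_mul_ballOscillation_le hu hv hs.1.le hs.2.le

theorem measurable_comp_heightPoint (hu : Measurable u) (t : ℝ) :
    Measurable fun z => u (heightPoint t z) :=
  hu.comp (continuous_heightPoint.comp (Continuous.prodMk_right t)).measurable

theorem locallyIntegrable_of_liminf_conjunctionIntegral_lt_top (hu : Measurable u)
    (hv : Measurable v)
    (h : liminf (fun s : ℝ => ENNReal.ofReal (1 - s) * conjunctionIntegral s u v)
      (𝓝[<] (1 : ℝ)) < ∞) :
    LocallyIntegrable v volume := by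
  have h_liminf := (liminf_ballOscillation_le_liminf_conjunctionIntegral hu hv).trans_lt
    (ENNReal.mul_lt_top (by finiteness) h)
  obtain ⟨t, h_lt, (ht : 0 < t)⟩ :=
    ((frequently_lt_of_liminf_lt (by isBoundedDefault) h_liminf).and_eventually
      self_mem_nhdsWithin).exists
  have h_osc : ballOscillation volume t v (fun z => u (heightPoint t z)) < ∞ := by
    contrapose! h_lt
    rw [top_le_iff.1 h_lt, ENNReal.top_div_of_ne_top (by finiteness)]
  exact locallyIntegrable_of_ballOscillation_lt_top hv (measurable_comp_heightPoint hu t) ht h_osc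

/-- The constant in the bound of the total variation by the trace conjunction integral:
`n = N - 1` coordinate directions, times the factor `2 ^ (n + 1) / |B₁|` lost in eliminating `u`,
times the factor `2 ^ (n + 2)` lost in bounding the kernel on balls. -/
noncomputable def traceConstant (n : ℕ) : ℝ≥0 :=
  n * (2 ^ (n + 1) / (volume (Metric.ball (0 : EuclideanSpace ℝ (Fin n)) 1)).toNNReal) *
    2 ^ (n + 2)

theorem coe_traceConstant (n : ℕ) :
    (traceConstant n : ℝ≥0∞) =
      n * (2 ^ (n + 1) / volume (Metric.ball (0 : EuclideanSpace ℝ (Fin n)) 1)) * 2 ^ (n + 2) := by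
  have h_ne_zero : (volume (Metric.ball (0 : EuclideanSpace ℝ (Fin n)) 1)).toNNReal ≠ 0 :=
    (ENNReal.toNNReal_pos (Metric.measure_ball_pos _ _ one_pos).ne' measure_ball_lt_top.ne).ne'
  simp only [traceConstant, ENNReal.coe_mul, ENNReal.coe_natCast, ENNReal.coe_div h_ne_zero,
    ENNReal.coe_pow, ENNReal.coe_ofNat, ENNReal.coe_toNNReal measure_ball_lt_top.ne]

theorem totalVariation_le_liminf_conjunctionIntegral (hu : Measurable u) (hv : Measurable v)
    (hv_loc : LocallyIntegrable v volume) :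
    totalVariation v ≤ traceConstant n *
      liminf (fun s : ℝ => ENNReal.ofReal (1 - s) * conjunctionIntegral s u v)
        (𝓝[<] (1 : ℝ)) := by
  rw [coe_traceConstant, mul_assoc, mul_assoc]
  refine (totalVariation_le_liminf_ballOscillation hv hv_loc
    (measurable_comp_heightPoint hu)).trans ?_
  gcongr
  exact liminf_ballOscillation_le_liminf_conjunctionIntegral hu hv

theorem conjunctionIntegral_congr {u' : EuclideanSpace ℝ (Fin (n + 1)) → ℝ}
    {v' : EuclideanSpace ℝ (Fin n) → ℝ} (hu : u =ᵐ[volume.restrict (halfSpace n)] u')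
    (hv : v =ᵐ[volume] v') (s : ℝ) : conjunctionIntegral s u v = conjunctionIntegral s u' v' := by
  refine lintegral_congr_ae (hv.mono fun x hx => lintegral_congr_ae (hu.mono fun y hy => ?_))
  simp only [hx, hy]

end Slicing

end TraceConjunction

/-- Here `N = n + 1` with `N ≥ 2`, and the constant `C` depends on `N` only. -/
theorem theorem8p4 (n : ℕ) (hn : 1 ≤ n) :
    ∃ C : ℝ≥0, ∀ (u : EuclideanSpace ℝ (Fin (n + 1)) → ℝ) (v : EuclideanSpace ℝ (Fin n) → ℝ),
      AEMeasurable u (volume.restrict (TraceConjunction.halfSpace n)) →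
      AEMeasurable v volume →
      liminf (fun s : ℝ => ENNReal.ofReal (1 - s) * TraceConjunction.conjunctionIntegral s u v)
        (𝓝[<] (1 : ℝ)) < ∞ →
      TraceConjunction.IsBV v ∧
        TraceConjunction.totalVariation v ≤
          (C : ℝ≥0∞) * liminf (fun s : ℝ =>
            ENNReal.ofReal (1 - s) * TraceConjunction.conjunctionIntegral s u v)
            (𝓝[<] (1 : ℝ)) := by
  open TraceConjunction in
  refine ⟨traceConstant n, fun u v hu hv hL => ?_⟩
  simp_rw [conjunctionIntegral_congr hu.ae_eq_mk hv.ae_eq_mk] at hL ⊢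
  set L := liminf (fun s : ℝ => ENNReal.ofReal (1 - s) *
    conjunctionIntegral s (hu.mk u) (hv.mk v)) (𝓝[<] (1 : ℝ))
  have h_loc : LocallyIntegrable (hv.mk v) volume :=
    locallyIntegrable_of_liminf_conjunctionIntegral_lt_top hu.measurable_mk hv.measurable_mk hL
  have h_le : totalVariation v ≤ traceConstant n * L := by
    rw [totalVariation_congr hv.ae_eq_mk]
    exact totalVariation_le_liminf_conjunctionIntegral hu.measurable_mk hv.measurable_mk h_loc
  exact ⟨⟨h_loc.congr hv.ae_eq_mk.symm,
    h_le.trans_lt (ENNReal.mul_lt_top ENNReal.coe_lt_top hL)⟩, h_le⟩
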